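/- For $n\ge 3$ let $GVB_n$ be Fang's generalized virtual braid group, that is, the group with generators $\sigma_1,\dots,\sigma_{n-1},\rho_1,\dots,\rho_{n-1}$ and defining relations \begin{align*} &\sigma_i\sigma_j=\sigma_j\sigma_i,\quad \rho_i\rho_j=\rho_j\rho_i,\quad \sigma_i\rho_j=\rho_j\sigma_i &&(1\le i,j\le n-1,\ |i-j|>1),\\ &\sigma_i\sigma_{i+1}\sigma_i=\sigma_{i+1}\sigma_i\sigma_{i+1},\quad \rho_i\rho_{i+1}\rho_i=\rho_{i+1}\rho_i\rho_{i+1} &&(1\le i\le n-2),\\ &\rho_i\sigma_{i+1}\sigma_i=\sigma_{i+1}\sigma_i\rho_{i+1},\quad \rho_{i+1}\sigma_i\sigma_{i+1}=\sigma_i\sigma_{i+1}\rho_i &&(1\le i\le n-2), \end{align*} and let $GVB_n'=[GVB_n,GVB_n]$ be its commutator subgroup. Then: (i) $GVB_n'$ is finitely generated for all $n\ge 4$; moreover, for $n\ge 5$, the rank of $GVB_n'$ (the smallest size of a generating set) is at most $3n-7$. (ii) There is a surjective homomorphism from $GVB_3'$ onto a free group of countably infinite rank, and $GVB_3'$ is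 not finitely generated. (iii) For $n\ge 3$, the group $GVB_n'$ is perfect (equal to its own commutator subgroup) if and only if $n\ge 5$. -/

import Mathlib

namespace GVBraid

/-- The generators `σ_i`, `ρ_i` of `GVB_n`, indexed by the `n - 1` elements of `Fin (n - 1)`
(the index `i : Fin (n - 1)` stands for `i + 1` in the usual numbering `1, …, n - 1`). -/
inductive Gen (n : ℕ) : Type
  | sigma (i : Fin (n - 1)) : Gen n
  | rho (i : Fin (n - 1)) : Gen n

/-- The free generator `σ_i`. -/
def σ {n : ℕ} (i : Fin (n - 1)) : FreeGroup (Gen n) := FreeGroup.of (Gen.sigma i)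

/-- The free generator `ρ_i`. -/
def ρ {n : ℕ} (i : Fin (n - 1)) : FreeGroup (Gen n) := FreeGroup.of (Gen.rho i)

/-- `Rel n u v` says that `u = v` is one of the defining relations of `GVB_n`. -/
inductive Rel (n : ℕ) : FreeGroup (Gen n) → FreeGroup (Gen n) → Prop
  | sigma_comm (i j : Fin (n - 1)) (h : 1 < |((i : ℕ) : ℤ) - ((j : ℕ) : ℤ)|) :
      Rel n (σ i * σ j) (σ j * σ i)
  | sigma_braid (i j : Fin (n - 1)) (h : (j : ℕ) = (i : ℕ) + 1) :
      Rel n (σ i * σ j * σ i) (σ j * σ i * σ j)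
  | rho_comm (i j : Fin (n - 1)) (h : 1 < |((i : ℕ) : ℤ) - ((j : ℕ) : ℤ)|) :
      Rel n (ρ i * ρ j) (ρ j * ρ i)
  | rho_braid (i j : Fin (n - 1)) (h : (j : ℕ) = (i : ℕ) + 1) :
      Rel n (ρ i * ρ j * ρ i) (ρ j * ρ i * ρ j)
  | mixed_left (i j : Fin (n - 1)) (h : (j : ℕ) = (i : ℕ) + 1) :
      Rel n (ρ i * σ j * σ i) (σ j * σ i * ρ j)
  | mixed_right (i j : Fin (n - 1)) (h : (j : ℕ) = (i : ℕ) + 1) :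
      Rel n (ρ j * σ i * σ j) (σ i * σ j * ρ i)
  | mixed_comm (i j : Fin (n - 1)) (h : 1 < |((i : ℕ) : ℤ) - ((j : ℕ) : ℤ)|) :
      Rel n (σ i * ρ j) (ρ j * σ i)

/-- The relators `u v⁻¹` of `GVB_n`. -/
def relators (n : ℕ) : Set (FreeGroup (Gen n)) :=
  {r | ∃ u v : FreeGroup (Gen n), Rel n u v ∧ r = u * v⁻¹}

/-- Fang's generalized virtual braid group on `n` strands. -/
abbrev GVB (n : ℕ) : Type := PresentedGroup (relators n)

/-- A group is perfect if it equals its own commutator subgroup. -/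
def IsPerfect (G : Type*) [Group G] : Prop := commutator G = ⊤

end GVBraid

namespace GVBraid

open Subgroup
open scoped commutatorElement

variable {G : Type*} [Group G]

/-! Indices start at 0, as in the code. A braid relation between x and y makes y x⁻¹ a commutator,
so all differences σ_i σ_0⁻¹ and ρ_i ρ_0⁻¹ lie in the commutator subgroup.

Perfectness. For n ≥ 5, σ_3 commutes with σ_0 and σ_1, and dividing both by it writes σ_1 σ_0⁻¹ as a
commutator of elements of GVB_n' (`braid_mem_commutator_commutator`). Likewise for ρ. Modulo the
second derived subgroup all σ_i then agree, all ρ_i agree, and σ_0 commutes with ρ_2 = ρ_0, so the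
quotient is abelian. For n = 3, 4, killing the ρ_i gives a map to S_3 under which GVB_n' has
nontrivial image in the abelian group A_3.

Finite generation. By `commutator_le_of_normalizer` it suffices to find a finitely generated
subgroup H of GVB_n' that contains the differences and is normalized by σ_0 and ρ_0. For n ≥ 5, the
differences and d = σ_0 ρ_0 σ_0⁻¹ ρ_3⁻¹ generate such an H: conjugation by g may be replaced by
conjugation by g' ∈ Hg, and far-away generators supply a g' commuting with the element at hand
(`mem_conjIn_of_commute`). For n = 4, H is generated by the braid part and all σ_0-power conjugates
of v = ρ_1 ρ_0⁻¹ and ρ_0 v ρ_0⁻¹. It is finitely generated because σ_0⁶ acts on v as an element of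
the braid part (`exists_pow_six_conj`).

Three strands. Sending both σ_i to the swap of two letters and both ρ_i to a letter maps GVB_3 to
F_2 ⋊ S_2. The commutator subgroup lands in the words of F_2 with total exponent zero, which map to
a free group on ℤ through F_2 → F_ℤ ⋊ ℤ. Every letter of that free group is attained. -/

/-- The elements `s 0, …, s (m - 1)` and `r 0, …, r (m - 1)` of a group satisfy the defining
relations of `GVB (m + 1)`. -/
structure Satisfies (m : ℕ) (s r : ℕ → G) : Prop where
  ss : ∀ i j, i + 1 < j → j < m → Commute (s i) (s j)
  rr : ∀ i j, i + 1 < j → j < m → Commute (r i) (r j)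
  sr : ∀ i j, i + 1 < j → j < m → Commute (s i) (r j)
  rs : ∀ i j, i + 1 < j → j < m → Commute (r i) (s j)
  sbraid : ∀ i, i + 1 < m → s i * s (i + 1) * s i = s (i + 1) * s i * s (i + 1)
  rbraid : ∀ i, i + 1 < m → r i * r (i + 1) * r i = r (i + 1) * r i * r (i + 1)
  mixedLeft : ∀ i, i + 1 < m → r i * s (i + 1) * s i = s (i + 1) * s i * r (i + 1)
  mixedRight : ∀ i, i + 1 < m → r (i + 1) * s i * s (i + 1) = s i * s (i + 1) * r i

theorem Satisfies.map {G' : Type*} [Group G'] {m : ℕ} {s r : ℕ → G} (h : Satisfies m s r)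
    (f : G →* G') : Satisfies m (fun i => f (s i)) (fun i => f (r i)) where
  ss i j hij hj := (h.ss i j hij hj).map f
  rr i j hij hj := (h.rr i j hij hj).map f
  sr i j hij hj := (h.sr i j hij hj).map f
  rs i j hij hj := (h.rs i j hij hj).map f
  sbraid i hi := by simpa only [map_mul] using congrArg f (h.sbraid i hi)
  rbraid i hi := by simpa only [map_mul] using congrArg f (h.rbraid i hi)
  mixedLeft i hi := by simpa only [map_mul] using congrArg f (h.mixedLeft i hi)
  mixedRight i hi := by simpa only [map_mul] using congrArg f (h.mixedRight i hi)

/-! ### The presentation and its universal property. -/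

/-- The homomorphism out of `GVB n` given by elements satisfying the defining relations. -/
def lift {n : ℕ} {s r : ℕ → G} (h : Satisfies (n - 1) s r) : GVB n →* G :=
  PresentedGroup.toGroup (rels := relators n)
    (f := fun g => match g with
      | Gen.sigma i => s i
      | Gen.rho i => r i) (by
    rintro _ ⟨u, v, huv, rfl⟩
    rw [_root_.map_mul, _root_.map_inv, mul_inv_eq_one]
    cases huv with
    | sigma_comm i j hij =>
      simp only [σ, map_mul, FreeGroup.lift_apply_of]
      rcases lt_abs.1 hij with hij | hij
      · exact (h.ss j i (by omega) i.2).eq.symm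
      · exact (h.ss i j (by omega) j.2).eq
    | sigma_braid i j hij =>
      simp only [σ, map_mul, FreeGroup.lift_apply_of, hij]
      exact h.sbraid i (by omega)
    | rho_comm i j hij =>
      simp only [ρ, map_mul, FreeGroup.lift_apply_of]
      rcases lt_abs.1 hij with hij | hij
      · exact (h.rr j i (by omega) i.2).eq.symm
      · exact (h.rr i j (by omega) j.2).eq
    | rho_braid i j hij =>
      simp only [ρ, map_mul, FreeGroup.lift_apply_of, hij]
      exact h.rbraid i (by omega)
    | mixed_left i j hij =>
      simp only [σ, ρ, map_mul, FreeGroup.lift_apply_of, hij]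
      exact h.mixedLeft i (by omega)
    | mixed_right i j hij =>
      simp only [σ, ρ, map_mul, FreeGroup.lift_apply_of, hij]
      exact h.mixedRight i (by omega)
    | mixed_comm i j hij =>
      simp only [σ, ρ, map_mul, FreeGroup.lift_apply_of]
      rcases lt_abs.1 hij with hij | hij
      · exact (h.rs j i (by omega) i.2).eq.symm
      · exact (h.sr i j (by omega) j.2).eq)

/-- The image of `σ_i` in `GVB n`, and `1` if the index is out of range. -/
def sigma (n i : ℕ) : GVB n :=
  if h : i < n - 1 then PresentedGroup.of (Gen.sigma ⟨i, h⟩) else 1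

/-- The image of `ρ_i` in `GVB n`, and `1` if the index is out of range. -/
def rho (n i : ℕ) : GVB n :=
  if h : i < n - 1 then PresentedGroup.of (Gen.rho ⟨i, h⟩) else 1

theorem lift_sigma {n : ℕ} {s r : ℕ → G} (h : Satisfies (n - 1) s r) {i : ℕ} (hi : i < n - 1) :
    lift h (sigma n i) = s i := by
  rw [sigma, dif_pos hi, lift, PresentedGroup.toGroup.of]

theorem lift_rho {n : ℕ} {s r : ℕ → G} (h : Satisfies (n - 1) s r) {i : ℕ} (hi : i < n - 1) :
    lift h (rho n i) = r i := by
  rw [rho, dif_pos hi, lift, PresentedGroup.toGroup.of]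

theorem mk_eq_of_rel {n : ℕ} {u v : FreeGroup (Gen n)} (h : Rel n u v) :
    PresentedGroup.mk (relators n) u = PresentedGroup.mk (relators n) v := by
  rw [← mul_inv_eq_one, ← _root_.map_inv, ← _root_.map_mul]
  exact PresentedGroup.one_of_mem ⟨u, v, h, rfl⟩

theorem satisfies_sigma_rho (n : ℕ) : Satisfies (n - 1) (sigma n) (rho n) where
  ss i j hij hj := by
    have hi : i < n - 1 := by omega
    have := mk_eq_of_rel (Rel.sigma_comm ⟨i, hi⟩ ⟨j, hj⟩ (lt_abs.2 (Or.inr (by simp; omega))))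
    simp only [sigma, dif_pos hi, dif_pos hj]
    exact this
  rr i j hij hj := by
    have hi : i < n - 1 := by omega
    have := mk_eq_of_rel (Rel.rho_comm ⟨i, hi⟩ ⟨j, hj⟩ (lt_abs.2 (Or.inr (by simp; omega))))
    simp only [rho, dif_pos hi, dif_pos hj]
    exact this
  sr i j hij hj := by
    have hi : i < n - 1 := by omega
    have := mk_eq_of_rel (Rel.mixed_comm ⟨i, hi⟩ ⟨j, hj⟩ (lt_abs.2 (Or.inr (by simp; omega))))
    simp only [sigma, rho, dif_pos hi, dif_pos hj]
    exact this
  rs i j hij hj := by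
    have hi : i < n - 1 := by omega
    have := (mk_eq_of_rel
      (Rel.mixed_comm ⟨j, hj⟩ ⟨i, hi⟩ (lt_abs.2 (Or.inl (by simp; omega))))).symm
    simp only [sigma, rho, dif_pos hi, dif_pos hj]
    exact this
  sbraid i hj := by
    have hi : i < n - 1 := by omega
    have := mk_eq_of_rel (Rel.sigma_braid ⟨i, hi⟩ ⟨i + 1, hj⟩ rfl)
    simp only [sigma, dif_pos hi, dif_pos hj]
    exact this
  rbraid i hj := by
    have hi : i < n - 1 := by omega
    have := mk_eq_of_rel (Rel.rho_braid ⟨i, hi⟩ ⟨i + 1, hj⟩ rfl)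
    simp only [rho, dif_pos hi, dif_pos hj]
    exact this
  mixedLeft i hj := by
    have hi : i < n - 1 := by omega
    have := mk_eq_of_rel (Rel.mixed_left ⟨i, hi⟩ ⟨i + 1, hj⟩ rfl)
    simp only [sigma, rho, dif_pos hi, dif_pos hj]
    exact this
  mixedRight i hj := by
    have hi : i < n - 1 := by omega
    have := mk_eq_of_rel (Rel.mixed_right ⟨i, hi⟩ ⟨i + 1, hj⟩ rfl)
    simp only [sigma, rho, dif_pos hi, dif_pos hj]
    exact this

theorem eq_top_of_sigma_rho_mem {n : ℕ} (H : Subgroup (GVB n))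
    (hs : ∀ i < n - 1, sigma n i ∈ H) (hr : ∀ i < n - 1, rho n i ∈ H) : H = ⊤ := by
  refine (eq_top_iff' H).2 (PresentedGroup.generated_by _ H ?_)
  rintro (i | i)
  · simpa only [sigma, dif_pos i.2] using hs i i.2
  · simpa only [rho, dif_pos i.2] using hr i i.2

/-- If a homomorphism sends all `σ_i` to one element and all `ρ_i` to one element commuting with
it, then it kills the commutator subgroup. -/
theorem commutator_le_ker {n : ℕ} (f : GVB n →* G) {a b : G} (hab : Commute a b)
    (hs : ∀ i < n - 1, f (sigma n i) = a) (hr : ∀ i < n - 1, f (rho n i) = b) :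
    commutator (GVB n) ≤ f.ker := by
  -- Used with `c = a` and `c = b` to make `a` and `b` central in the image, then with `c = f x`.
  have key : ∀ c, Commute c a → Commute c b → ∀ x, Commute c (f x) := by
    intro c hca hcb x
    have : (centralizer {c}).comap f = ⊤ := by
      refine eq_top_of_sigma_rho_mem _ (fun i hi => ?_) (fun i hi => ?_)
      · rw [mem_comap, hs i hi, mem_centralizer_singleton_iff]; exact hca.symm.eq
      · rw [mem_comap, hr i hi, mem_centralizer_singleton_iff]; exact hcb.symm.eq
    have hx : x ∈ (centralizer {c}).comap f := this ▸ mem_top x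
    rw [mem_comap, mem_centralizer_singleton_iff] at hx
    exact hx.symm
  rw [commutator_def, commutator_le]
  intro x _ y _
  rw [MonoidHom.mem_ker, map_commutatorElement, commutatorElement_eq_one_iff_commute]
  exact key (f x) (key a (Commute.refl a) hab x).symm (key b hab.symm (Commute.refl b) x).symm y

/-! ### Differences of braided generators are commutators. -/

/-- Conjugation by `x * y` carries `x` to `y`. -/
theorem commutatorElement_of_braid {x y : G} (h : x * y * x = y * x * y) :
    ⁅x * y, x⁆ = y * x⁻¹ := by
  rw [commutatorElement_def, h]
  group

theorem mul_inv_mem_commutator_of_braid {x y : G} (h : x * y * x = y * x * y) :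
    y * x⁻¹ ∈ commutator G := by
  rw [← commutatorElement_of_braid h]
  exact commutator_mem_commutator (mem_top _) (mem_top _)

theorem Satisfies.s_mem_commutator {m : ℕ} {s r : ℕ → G} (h : Satisfies m s r) :
    ∀ i < m, s i * (s 0)⁻¹ ∈ commutator G
  | 0, _ => by simp
  | i + 1, hi => by
    have h1 := h.s_mem_commutator i (by omega)
    have h2 := mul_inv_mem_commutator_of_braid (h.sbraid i hi)
    simpa [mul_assoc] using mul_mem h2 h1

theorem Satisfies.r_mem_commutator {m : ℕ} {s r : ℕ → G} (h : Satisfies m s r) :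
    ∀ i < m, r i * (r 0)⁻¹ ∈ commutator G
  | 0, _ => by simp
  | i + 1, hi => by
    have h1 := h.r_mem_commutator i (by omega)
    have h2 := mul_inv_mem_commutator_of_braid (h.rbraid i hi)
    simpa [mul_assoc] using mul_mem h2 h1

/-! ### Perfectness for at least five strands -/

/-- Two elements satisfying the braid relation and commuting with a third element that has the same
image in the abelianization are congruent modulo the second derived subgroup. -/
theorem braid_mem_commutator_commutator {x y z : G} (h : x * y * x = y * x * y)
    (hx : Commute x z) (hy : Commute y z) (hxz : z * x⁻¹ ∈ commutator G) :
    y * x⁻¹ ∈ ⁅commutator G, commutator G⁆ := by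
  have hxz' : x * z⁻¹ ∈ commutator G := by simpa using inv_mem hxz
  have hyz : y * z⁻¹ ∈ commutator G := by
    simpa [mul_assoc] using mul_mem (mul_inv_mem_commutator_of_braid h) hxz'
  have hy' : z⁻¹ * y = y * z⁻¹ := hy.inv_right.eq.symm
  -- Since `z` commutes with `x` and `y`, dividing by it leaves the commutator unchanged but moves
  -- both entries into the commutator subgroup.
  have e : ⁅(x * z⁻¹) * (y * z⁻¹), x * z⁻¹⁆ = ⁅x * y, x⁆ := by
    have hw : Commute (x * y) z := hx.mul_left hy
    have e1 : (x * z⁻¹) * (y * z⁻¹) = (x * y) * (z⁻¹ * z⁻¹) := by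
      rw [mul_assoc x, ← mul_assoc z⁻¹ y, hy']; group
    rw [e1, commutatorElement_def, commutatorElement_def]
    have c1 : Commute (z⁻¹ * z⁻¹) (x * z⁻¹) :=
      (hx.symm.inv_left.mul_left hx.symm.inv_left).mul_right (by
        exact ((Commute.refl z⁻¹).mul_left (Commute.refl z⁻¹)))
    have c2 : Commute z⁻¹ (x * y)⁻¹ := hw.symm.inv_left.inv_right
    calc x * y * (z⁻¹ * z⁻¹) * (x * z⁻¹) * (x * y * (z⁻¹ * z⁻¹))⁻¹ * (x * z⁻¹)⁻¹
        = x * y * ((z⁻¹ * z⁻¹) * (x * z⁻¹)) * (z⁻¹ * z⁻¹)⁻¹ * (x * y)⁻¹ * (x * z⁻¹)⁻¹ := by group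
      _ = x * y * x * (z⁻¹ * (x * y)⁻¹) * z * x⁻¹ := by rw [c1.eq]; group
      _ = x * y * x * (x * y)⁻¹ * x⁻¹ := by rw [c2.eq]; group
  rw [← commutatorElement_of_braid h, ← e]
  exact commutator_mem_commutator (mul_mem hxz' hyz) hxz'

theorem eq_of_braid_of_commute {x y : G} (h : x * y * x = y * x * y) (c : Commute x y) :
    x = y := by
  rw [c.eq, mul_assoc, mul_assoc, c.eq] at h
  exact mul_right_cancel (mul_left_cancel h)

/-- Once two neighbours agree, `t (k + 2)` commutes with `t k = t (k + 1)`, and commuting braided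
elements coincide. -/
theorem eq_of_braid_chain {m : ℕ} {t : ℕ → G}
    (comm : ∀ i j, i + 1 < j → j < m → Commute (t i) (t j))
    (braid : ∀ i, i + 1 < m → t i * t (i + 1) * t i = t (i + 1) * t i * t (i + 1))
    (h01 : t 1 = t 0) : ∀ i < m, t i = t 0 := by
  intro i
  induction i using Nat.strong_induction_on with
  | _ i ih =>
    intro hi
    match i, ih, hi with
    | 0, _, _ => rfl
    | 1, _, _ => exact h01
    | k + 2, ih, hi =>
      have h1 := ih (k + 1) (by omega) (by omega)
      have h0 := ih k (by omega) (by omega)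
      have c := comm k (k + 2) (by omega) hi
      rw [h0, ← h1] at c
      rw [← h1, eq_of_braid_of_commute (braid (k + 1) hi) c]

theorem commutator_le_commutator_commutator {n : ℕ} (hn : 5 ≤ n) :
    commutator (GVB n) ≤ ⁅commutator (GVB n), commutator (GVB n)⁆ := by
  have S := satisfies_sigma_rho n
  let π := QuotientGroup.mk' ⁅commutator (GVB n), commutator (GVB n)⁆
  -- Index 3 is at distance at least two from both 0 and 1; it exists exactly when `5 ≤ n`.
  have hs : sigma n 1 * (sigma n 0)⁻¹ ∈ ⁅commutator (GVB n), commutator (GVB n)⁆ :=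
    braid_mem_commutator_commutator (S.sbraid 0 (by omega)) (S.ss 0 3 (by omega) (by omega))
      (S.ss 1 3 (by omega) (by omega)) (S.s_mem_commutator 3 (by omega))
  have hr : rho n 1 * (rho n 0)⁻¹ ∈ ⁅commutator (GVB n), commutator (GVB n)⁆ :=
    braid_mem_commutator_commutator (S.rbraid 0 (by omega)) (S.rr 0 3 (by omega) (by omega))
      (S.rr 1 3 (by omega) (by omega)) (S.r_mem_commutator 3 (by omega))
  rw [← QuotientGroup.ker_mk' ⁅commutator (GVB n), commutator (GVB n)⁆, MonoidHom.mem_ker,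
    map_mul, map_inv, mul_inv_eq_one] at hs hr
  have T := S.map π
  have es := eq_of_braid_chain T.ss T.sbraid hs
  have er := eq_of_braid_chain T.rr T.rbraid hr
  have hab : Commute (π (sigma n 0)) (π (rho n 0)) := by
    have := T.sr 0 2 (by omega) (by omega)
    rwa [er 2 (by omega)] at this
  have := commutator_le_ker π hab es er
  rwa [QuotientGroup.ker_mk'] at this

theorem isPerfect_commutator {n : ℕ} (hn : 5 ≤ n) : IsPerfect (commutator (GVB n)) := by
  have h := commutator_le_commutator_commutator hn
  rw [← map_subtype_commutator] at h
  refine (eq_top_iff' _).2 fun x => ?_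
  obtain ⟨y, hy, hyx⟩ := h x.2
  rwa [← Subtype.ext hyx]

/-! ### Failure of perfectness for three and four strands -/

/-- Indices 0 and 2 share a transposition: this is the surjection B_4 → B_3 → S_3, with every ρ
killed. -/
theorem satisfies_perm : Satisfies 3
    (fun i => if i = 1 then Equiv.swap 1 2 else Equiv.swap 0 1 : ℕ → Equiv.Perm (Fin 3))
    (fun _ => 1) where
  ss i j hij hj := by
    obtain ⟨rfl, rfl⟩ : i = 0 ∧ j = 2 := by omega
    exact Commute.refl _
  rr _ _ _ _ := Commute.refl _
  sr _ _ _ _ := Commute.one_right _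
  rs _ _ _ _ := Commute.one_left _
  sbraid i hi := by
    obtain rfl | rfl : i = 0 ∨ i = 1 := by omega
    all_goals decide
  rbraid _ _ := rfl
  mixedLeft i hi := by simp
  mixedRight i hi := by simp

theorem Satisfies.mono {m k : ℕ} {s r : ℕ → G} (h : Satisfies m s r) (hk : k ≤ m) :
    Satisfies k s r where
  ss i j hij hj := h.ss i j hij (hj.trans_le hk)
  rr i j hij hj := h.rr i j hij (hj.trans_le hk)
  sr i j hij hj := h.sr i j hij (hj.trans_le hk)
  rs i j hij hj := h.rs i j hij (hj.trans_le hk)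
  sbraid i hi := h.sbraid i (hi.trans_le hk)
  rbraid i hi := h.rbraid i (hi.trans_le hk)
  mixedLeft i hi := h.mixedLeft i (hi.trans_le hk)
  mixedRight i hi := h.mixedRight i (hi.trans_le hk)

theorem mul_comm_of_sign_eq_one (a b : Equiv.Perm (Fin 3)) (ha : Equiv.Perm.sign a = 1)
    (hb : Equiv.Perm.sign b = 1) : a * b = b * a := by
  revert a b
  decide

theorem not_isPerfect_commutator {n : ℕ} (hn : 3 ≤ n) (hn' : n ≤ 4) :
    ¬ IsPerfect (commutator (GVB n)) := by
  intro hp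
  have T := satisfies_perm.mono (show n - 1 ≤ 3 by omega)
  have hsign : commutator (GVB n) ≤ (Equiv.Perm.sign.comp (lift T)).ker :=
    Abelianization.commutator_subset_ker _
  have hker : commutator (commutator (GVB n)) ≤
      ((lift T).comp (commutator (GVB n)).subtype).ker := by
    rw [_root_.commutator_def (commutator (GVB n)), commutator_le]
    intro x _ y _
    rw [MonoidHom.mem_ker, map_commutatorElement, commutatorElement_eq_one_iff_mul_comm]
    exact mul_comm_of_sign_eq_one _ _ (hsign x.2) (hsign y.2)
  -- This element maps to a 3-cycle, whereas the second derived subgroup maps to 1.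
  have hmem := (satisfies_sigma_rho n).s_mem_commutator 1 (by omega)
  have h1 : (⟨_, hmem⟩ : commutator (GVB n)) ∈ commutator (commutator (GVB n)) := by
    rw [show commutator (commutator (GVB n)) = ⊤ from hp]
    exact mem_top _
  have h2 := hker h1
  rw [MonoidHom.mem_ker, MonoidHom.comp_apply, coe_subtype, map_mul, map_inv,
    lift_sigma T (by omega), lift_sigma T (by omega)] at h2
  revert h2
  decide

/-! ### Normalizers, and generators for at least five strands. -/

/-- The elements whose conjugates by `g` and by `g⁻¹` lie in `H`. -/
def conjIn (H : Subgroup G) (g : G) : Subgroup G :=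
  H.comap (MulAut.conj g).toMonoidHom ⊓ H.comap (MulAut.conj g⁻¹).toMonoidHom

theorem mem_conjIn {H : Subgroup G} {g x : G} :
    x ∈ conjIn H g ↔ g * x * g⁻¹ ∈ H ∧ g⁻¹ * x * g ∈ H := by
  simp [conjIn, mem_inf]

theorem mem_normalizer_of_le_conjIn {H : Subgroup G} {g : G} (h : H ≤ conjIn H g) :
    g ∈ normalizer (H : Set G) := by
  rw [mem_normalizer_iff]
  refine fun x => ⟨fun hx => (mem_conjIn.1 (h hx)).1, fun hx => ?_⟩
  simpa [mul_assoc] using (mem_conjIn.1 (h hx)).2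

theorem le_conjIn_of_mem_normalizer {H : Subgroup G} {g : G} (h : g ∈ normalizer (H : Set G)) :
    H ≤ conjIn H g :=
  fun x hx => mem_conjIn.2 ⟨(mem_normalizer_iff.1 h x).1 hx, (mem_normalizer_iff''.1 h x).1 hx⟩

/-- To conjugate by `g` one may use any element of the coset `H * g` commuting with `g`. -/
theorem mem_conjIn_of_commute {H : Subgroup G} {g g' x : G} (hg : g' * g⁻¹ ∈ H)
    (hgg : Commute g g') (hx : x ∈ H) (hc : Commute g' x) : x ∈ conjIn H g := by
  have e : g' * x * g'⁻¹ = x := by rw [hc.eq]; group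
  have e' : g'⁻¹ * x * g' = x := by rw [mul_assoc, ← hc.eq]; group
  refine mem_conjIn.2 ⟨?_, ?_⟩
  · have : g * x * g⁻¹ = (g' * g⁻¹)⁻¹ * (g' * x * g'⁻¹) * (g' * g⁻¹) := by group
    rw [this, e]
    exact mul_mem (mul_mem (inv_mem hg) hx) hg
  · have : g⁻¹ * x * g = (g⁻¹ * g') * (g'⁻¹ * x * g') * (g⁻¹ * g')⁻¹ := by group
    rw [this, e', hgg.inv_left.eq]
    exact mul_mem (mul_mem hg hx) (inv_mem hg)

theorem commute_mul_inv {x y z : G} (hy : Commute x y) (hz : Commute x z) :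
    Commute x (y * z⁻¹) :=
  hy.mul_right hz.inv_right

/-- Only `t 1` fails to commute with `t 0`; there `t 3` replaces `t 0` as the conjugating element.
-/
theorem braid_chain_mem_conjIn {m : ℕ} (hm : 4 ≤ m) {t : ℕ → G} {H : Subgroup G}
    (comm : ∀ i j, i + 1 < j → j < m → Commute (t i) (t j))
    (ht : ∀ i < m, t i * (t 0)⁻¹ ∈ H) : ∀ i < m, t i * (t 0)⁻¹ ∈ conjIn H (t 0)
  | 0, _ => by simp
  | 1, hi => mem_conjIn_of_commute (ht 3 (by omega)) (comm 0 3 (by omega) (by omega)) (ht 1 hi)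
      (commute_mul_inv (comm 1 3 (by omega) (by omega)).symm (comm 0 3 (by omega) (by omega)).symm)
  | i + 2, hi => mem_conjIn_of_commute (by simp) (Commute.refl _) (ht _ hi)
      (commute_mul_inv (comm 0 (i + 2) (by omega) hi) (Commute.refl _))

/-- Differences of elements of a chain `t` are well behaved under conjugation by an element `g 0` of
a second chain `g` as soon as `t 3 * (t 0)⁻¹` is. -/
theorem mixed_chain_mem_conjIn {m : ℕ} (hm : 4 ≤ m) {t g : ℕ → G} {H : Subgroup G}
    (gg : ∀ i j, i + 1 < j → j < m → Commute (g i) (g j))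
    (tg : ∀ i j, i + 1 < j → j < m → Commute (t i) (g j))
    (gt : ∀ i j, i + 1 < j → j < m → Commute (g i) (t j))
    (ht : ∀ i < m, t i * (t 0)⁻¹ ∈ H) (hg : ∀ i < m, g i * (g 0)⁻¹ ∈ H)
    (h3 : t 3 * (t 0)⁻¹ ∈ conjIn H (g 0)) : ∀ i < m, t i * (t 0)⁻¹ ∈ conjIn H (g 0)
  | 0, _ => by simp
  | 1, hi => mem_conjIn_of_commute (hg 3 (by omega)) (gg 0 3 (by omega) (by omega)) (ht 1 hi)
      (commute_mul_inv (tg 1 3 (by omega) (by omega)).symm (tg 0 3 (by omega) (by omega)).symm)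
  | 2, hi => by
    -- `g 0` commutes with `t 2` and `t 3` but need not commute with `t 0`, so the difference is
    -- split at `t 3`.
    have h : t 2 * (t 3)⁻¹ ∈ conjIn H (g 0) := by
      refine mem_conjIn_of_commute (by simp) (Commute.refl _) ?_
        (commute_mul_inv (gt 0 2 (by omega) (by omega)) (gt 0 3 (by omega) (by omega)))
      simpa [mul_assoc] using mul_mem (ht 2 hi) (inv_mem (ht 3 (by omega)))
    simpa [mul_assoc] using mul_mem h h3
  | 3, _ => h3
  | i + 4, hi => mem_conjIn_of_commute (hg 2 (by omega)) (gg 0 2 (by omega) (by omega)) (ht _ hi)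
      (commute_mul_inv (gt 2 (i + 4) (by omega) (by omega)) (tg 0 2 (by omega) (by omega)).symm)

namespace Satisfies

variable {m : ℕ} {s r : ℕ → G} {H : Subgroup G}

/-- The critical element is e = r_0 r_3⁻¹, with d = s_0 e s_0⁻¹. The mixed relations control s_0⁻¹ e
s_0 and s_0 d s_0⁻¹, since s_1 s_0 and s_0 s_1 both agree with s_0² up to a conjugate of s_1 s_0⁻¹
that lies in `H`. -/
theorem rho_mem_conjIn_sigma (h : Satisfies m s r) (hm : 4 ≤ m)
    (hs : ∀ i < m, s i * (s 0)⁻¹ ∈ H) (hr : ∀ i < m, r i * (r 0)⁻¹ ∈ H)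
    (hd : s 0 * r 0 * (s 0)⁻¹ * (r 3)⁻¹ ∈ H) :
    (∀ i < m, r i * (r 0)⁻¹ ∈ conjIn H (s 0)) ∧
      s 0 * r 0 * (s 0)⁻¹ * (r 3)⁻¹ ∈ conjIn H (s 0) := by
  obtain ⟨ha, ha'⟩ := mem_conjIn.1 (braid_chain_mem_conjIn hm h.ss hs 1 (by omega))
  have hb : r 1 * (r 0)⁻¹ ∈ conjIn H (s 0) :=
    mem_conjIn_of_commute (hs 3 (by omega)) (h.ss 0 3 (by omega) (by omega)) (hr 1 (by omega))
      (commute_mul_inv (h.rs 1 3 (by omega) (by omega)).symm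
        (h.rs 0 3 (by omega) (by omega)).symm)
  replace hb := (mem_conjIn.1 hb).1
  have he3 : r 0 * (r 3)⁻¹ ∈ H := by simpa using inv_mem (hr 3 (by omega))
  have h13 : r 1 * (r 3)⁻¹ ∈ H := by simpa [mul_assoc] using mul_mem (hr 1 (by omega)) he3
  have c03 : Commute (s 0) (r 3) := h.sr 0 3 (by omega) (by omega)
  have c13 : Commute (s 1) (r 3) := h.sr 1 3 (by omega) (by omega)
  have hde : s 0 * (r 0 * (r 3)⁻¹) * (s 0)⁻¹ = s 0 * r 0 * (s 0)⁻¹ * (r 3)⁻¹ := by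
    rw [mul_assoc, mul_assoc (r 0), ← c03.inv_left.inv_right.eq]
    group
  -- conjugation by `s 0 * s 1` moves `r 0` to `r 1` and fixes `r 3`
  have hup : s 0 * s 1 * (r 0 * (r 3)⁻¹) * (s 0 * s 1)⁻¹ = r 1 * (r 3)⁻¹ := by
    have c : Commute (s 0 * s 1) (r 3) := c03.mul_left c13
    rw [← mul_assoc, ← h.mixedRight 0 (by omega), mul_assoc (_ * s 1),
      ← c.inv_left.inv_right.eq]
    group
  have hdown : s 1 * s 0 * (r 1 * (r 3)⁻¹) * (s 1 * s 0)⁻¹ = r 0 * (r 3)⁻¹ := by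
    have c : Commute (s 1 * s 0) (r 3) := c13.mul_left c03
    rw [← mul_assoc, ← h.mixedLeft 0 (by omega), mul_assoc (_ * s 0),
      ← c.inv_left.inv_right.eq]
    group
  have he : r 0 * (r 3)⁻¹ ∈ conjIn H (s 0) := by
    refine mem_conjIn.2 ⟨hde ▸ hd, ?_⟩
    -- Write e as the conjugate of r_1 r_3⁻¹ by s_1 s_0, and split r_1 r_3⁻¹ at r_0.
    have e1 : (s 0)⁻¹ * (r 0 * (r 3)⁻¹) * s 0 = ((s 0)⁻¹ * (s 1 * (s 0)⁻¹) * s 0) *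
        ((s 0 * (r 1 * (r 0)⁻¹) * (s 0)⁻¹) * (s 0 * (r 0 * (r 3)⁻¹) * (s 0)⁻¹)) *
        ((s 0)⁻¹ * (s 1 * (s 0)⁻¹) * s 0)⁻¹ := by
      nth_rw 1 [← hdown]
      simp [mul_assoc]
    rw [e1, hde]
    exact mul_mem (mul_mem ha' (mul_mem hb hd)) (inv_mem ha')
  have hdm : s 0 * r 0 * (s 0)⁻¹ * (r 3)⁻¹ ∈ conjIn H (s 0) := by
    rw [← hde]
    refine mem_conjIn.2 ⟨?_, by simpa [mul_assoc] using he3⟩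
    have e1 : s 0 * (s 0 * (r 0 * (r 3)⁻¹) * (s 0)⁻¹) * (s 0)⁻¹ =
        (s 0 * (s 1 * (s 0)⁻¹) * (s 0)⁻¹)⁻¹ * (s 0 * s 1 * (r 0 * (r 3)⁻¹) * (s 0 * s 1)⁻¹) *
        (s 0 * (s 1 * (s 0)⁻¹) * (s 0)⁻¹) := by simp [mul_assoc]
    rw [e1, hup]
    exact mul_mem (mul_mem (inv_mem ha) h13) ha
  refine ⟨mixed_chain_mem_conjIn hm h.ss h.rs h.sr hr hs ?_, hdm⟩
  simpa using inv_mem he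

/-- `r 3` commutes with every factor of d, so it can replace `r 0` there. Conjugating s_3 s_0⁻¹ by
r_0 changes it only through the commutator of s_0 and r_0, which is d times a difference. -/
theorem sigma_mem_conjIn_rho (h : Satisfies m s r) (hm : 4 ≤ m)
    (hs : ∀ i < m, s i * (s 0)⁻¹ ∈ H) (hr : ∀ i < m, r i * (r 0)⁻¹ ∈ H)
    (hd : s 0 * r 0 * (s 0)⁻¹ * (r 3)⁻¹ ∈ H) :
    (∀ i < m, s i * (s 0)⁻¹ ∈ conjIn H (r 0)) ∧
      s 0 * r 0 * (s 0)⁻¹ * (r 3)⁻¹ ∈ conjIn H (r 0) := by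
  have c03 : Commute (s 0) (r 3) := h.sr 0 3 (by omega) (by omega)
  have cr : Commute (r 0) (r 3) := h.rr 0 3 (by omega) (by omega)
  have c30 : Commute (r 0) (s 3) := h.rs 0 3 (by omega) (by omega)
  have hdm : s 0 * r 0 * (s 0)⁻¹ * (r 3)⁻¹ ∈ conjIn H (r 0) :=
    mem_conjIn_of_commute (hr 3 (by omega)) cr hd
      (((c03.symm.mul_right cr.symm).mul_right c03.symm.inv_right).mul_right
        (Commute.refl (r 3)).inv_right)
  have ht : s 0 * r 0 * (s 0)⁻¹ * (r 0)⁻¹ ∈ conjIn H (r 0) := by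
    have := mul_mem hdm (braid_chain_mem_conjIn hm h.rr hr 3 (by omega))
    simpa [mul_assoc] using this
  have htH : s 0 * r 0 * (s 0)⁻¹ * (r 0)⁻¹ ∈ H := by
    simpa [mul_assoc] using mul_mem hd (hr 3 (by omega))
  refine ⟨mixed_chain_mem_conjIn hm h.rr h.sr h.rs hs hr ?_, hdm⟩
  refine mem_conjIn.2 ⟨?_, ?_⟩
  · have : r 0 * (s 3 * (s 0)⁻¹) * (r 0)⁻¹ =
        (s 3 * (s 0)⁻¹) * (s 0 * r 0 * (s 0)⁻¹ * (r 0)⁻¹) := by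
      rw [← mul_assoc, c30.eq]; group
    rw [this]
    exact mul_mem (hs 3 (by omega)) htH
  · have : (r 0)⁻¹ * (s 3 * (s 0)⁻¹) * r 0 =
        (s 3 * (s 0)⁻¹) * ((r 0)⁻¹ * (s 0 * r 0 * (s 0)⁻¹ * (r 0)⁻¹) * r 0)⁻¹ := by
      rw [← mul_assoc, c30.inv_left.eq]; group
    rw [this]
    exact mul_mem (hs 3 (by omega)) (inv_mem (mem_conjIn.1 ht).2)

end Satisfies

/-- A subgroup of `GVB n` containing the differences `σ_i σ_0⁻¹`, `ρ_i ρ_0⁻¹` and normalized by `σ_0`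
and `ρ_0` contains the commutator subgroup. -/
theorem commutator_le_of_normalizer {n : ℕ} (hn : 4 ≤ n) {H : Subgroup (GVB n)}
    (hs : ∀ i < n - 1, sigma n i * (sigma n 0)⁻¹ ∈ H)
    (hr : ∀ i < n - 1, rho n i * (rho n 0)⁻¹ ∈ H)
    (hs0 : sigma n 0 ∈ normalizer (H : Set (GVB n)))
    (hr0 : rho n 0 ∈ normalizer (H : Set (GVB n))) : commutator (GVB n) ≤ H := by
  have hN : H.Normal := by
    refine normalizer_eq_top_iff.1 (eq_top_of_sigma_rho_mem _ (fun i hi => ?_) (fun i hi => ?_))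
    · simpa using mul_mem (le_normalizer (hs i hi)) hs0
    · simpa using mul_mem (le_normalizer (hr i hi)) hr0
  have es : ∀ i < n - 1, QuotientGroup.mk' H (sigma n i) = QuotientGroup.mk' H (sigma n 0) := by
    intro i hi
    rw [← mul_inv_eq_one, ← map_inv, ← map_mul, ← MonoidHom.mem_ker, QuotientGroup.ker_mk']
    exact hs i hi
  have er : ∀ i < n - 1, QuotientGroup.mk' H (rho n i) = QuotientGroup.mk' H (rho n 0) := by
    intro i hi
    rw [← mul_inv_eq_one, ← map_inv, ← map_mul, ← MonoidHom.mem_ker, QuotientGroup.ker_mk']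
    exact hr i hi
  have hab : Commute (QuotientGroup.mk' H (sigma n 0)) (QuotientGroup.mk' H (rho n 0)) := by
    rw [← er 2 (by omega)]
    exact ((satisfies_sigma_rho n).sr 0 2 (by omega) (by omega)).map _
  simpa only [QuotientGroup.ker_mk'] using commutator_le_ker _ hab es er

open Classical in
/-- A generating set of the commutator subgroup of `GVB n` for `5 ≤ n`. -/
noncomputable def commutatorGenerators (n : ℕ) : Finset (GVB n) :=
  (Finset.Ico 1 (n - 1)).image (fun i => sigma n i * (sigma n 0)⁻¹) ∪
    (Finset.Ico 1 (n - 1)).image (fun i => rho n i * (rho n 0)⁻¹) ∪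
    {sigma n 0 * rho n 0 * (sigma n 0)⁻¹ * (rho n 3)⁻¹}

theorem card_commutatorGenerators_le (n : ℕ) :
    (commutatorGenerators n).card ≤ (n - 2) + (n - 2) + 1 := by
  classical
  refine (Finset.card_union_le _ _).trans (add_le_add ((Finset.card_union_le _ _).trans
    (add_le_add (Finset.card_image_le.trans ?_) (Finset.card_image_le.trans ?_))) (by simp))
  all_goals simp; omega

theorem closure_commutatorGenerators {n : ℕ} (hn : 5 ≤ n) :
    closure (commutatorGenerators n : Set (GVB n)) = commutator (GVB n) := by
  have S := satisfies_sigma_rho n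
  set H := closure (commutatorGenerators n : Set (GVB n)) with hH
  have le_iff : ∀ K : Subgroup (GVB n), (∀ i < n - 1, sigma n i * (sigma n 0)⁻¹ ∈ K) →
      (∀ i < n - 1, rho n i * (rho n 0)⁻¹ ∈ K) →
      sigma n 0 * rho n 0 * (sigma n 0)⁻¹ * (rho n 3)⁻¹ ∈ K → H ≤ K := by
    intro K h1 h2 h3
    rw [hH, closure_le]
    intro x hx
    simp only [commutatorGenerators, Finset.coe_union, Finset.coe_image, Finset.coe_Ico,
      Finset.coe_singleton, Set.mem_union, Set.mem_image, Set.mem_Ico,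
      Set.mem_singleton_iff] at hx
    rcases hx with (⟨i, hi, rfl⟩ | ⟨i, hi, rfl⟩) | rfl
    exacts [h1 i hi.2, h2 i hi.2, h3]
  have hs : ∀ i < n - 1, sigma n i * (sigma n 0)⁻¹ ∈ H := by
    intro i hi
    rcases Nat.eq_zero_or_pos i with rfl | hi0
    · simp
    · refine subset_closure ?_
      simp only [commutatorGenerators, Finset.coe_union, Finset.coe_image, Finset.coe_Ico]
      exact Or.inl (Or.inl ⟨i, ⟨hi0, hi⟩, rfl⟩)
  have hr : ∀ i < n - 1, rho n i * (rho n 0)⁻¹ ∈ H := by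
    intro i hi
    rcases Nat.eq_zero_or_pos i with rfl | hi0
    · simp
    · refine subset_closure ?_
      simp only [commutatorGenerators, Finset.coe_union, Finset.coe_image, Finset.coe_Ico]
      exact Or.inl (Or.inr ⟨i, ⟨hi0, hi⟩, rfl⟩)
  have hd : sigma n 0 * rho n 0 * (sigma n 0)⁻¹ * (rho n 3)⁻¹ ∈ H := by
    refine subset_closure ?_
    simp [commutatorGenerators]
  apply le_antisymm
  · refine le_iff _ S.s_mem_commutator S.r_mem_commutator ?_
    have h1 : ⁅sigma n 0, rho n 0⁆ ∈ commutator (GVB n) :=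
      commutator_mem_commutator (mem_top _) (mem_top _)
    rw [commutatorElement_def] at h1
    simpa [mul_assoc] using mul_mem h1 (inv_mem (S.r_mem_commutator 3 (by omega)))
  · have hσ := S.rho_mem_conjIn_sigma (by omega) hs hr hd
    have hρ := S.sigma_mem_conjIn_rho (by omega) hs hr hd
    refine commutator_le_of_normalizer (by omega) hs hr
      (mem_normalizer_of_le_conjIn (le_iff _ ?_ hσ.1 hσ.2))
      (mem_normalizer_of_le_conjIn (le_iff _ hρ.1 ?_ hρ.2))
    · exact braid_chain_mem_conjIn (by omega) S.ss hs
    · exact braid_chain_mem_conjIn (by omega) S.rr hr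

theorem rank_commutator_le {n : ℕ} (hn : 5 ≤ n) :
    ∃ _ : Group.FG (commutator (GVB n)), Group.rank (commutator (GVB n)) ≤ 3 * n - 7 := by
  rw [← closure_commutatorGenerators hn]
  refine ⟨inferInstance, (rank_closure_finset_le_card _).trans
    ((card_commutatorGenerators_le n).trans ?_)⟩
  -- The generating set has at most 2n - 3 elements, and 2n - 3 ≤ 3n - 7 once n ≥ 4.
  omega

/-! ### Adjoining conjugates by powers of one element. -/

/-- The subgroup generated by `K` and all conjugates of `x` by powers of `g`. -/
def conjHull (K : Subgroup G) (g x : G) : Subgroup G :=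
  closure ((K : Set G) ∪ Set.range fun k : ℤ => g ^ k * x * (g ^ k)⁻¹)

theorem le_conjHull (K : Subgroup G) (g x : G) : K ≤ conjHull K g x :=
  fun _ hy => subset_closure (Or.inl hy)

theorem zpow_conj_mem_conjHull (K : Subgroup G) (g x : G) (k : ℤ) :
    g ^ k * x * (g ^ k)⁻¹ ∈ conjHull K g x :=
  subset_closure (Or.inr ⟨k, rfl⟩)

theorem self_mem_conjHull (K : Subgroup G) (g x : G) : x ∈ conjHull K g x := by
  simpa using zpow_conj_mem_conjHull K g x 0

theorem conjHull_le {K L : Subgroup G} {g x : G} (hK : K ≤ L)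
    (hx : ∀ k : ℤ, g ^ k * x * (g ^ k)⁻¹ ∈ L) : conjHull K g x ≤ L := by
  refine (closure_le L).2 (Set.union_subset hK ?_)
  rintro _ ⟨k, rfl⟩
  exact hx k

theorem mem_normalizer_conjHull {K : Subgroup G} {g : G} (hg : g ∈ normalizer (K : Set G))
    (x : G) : g ∈ normalizer (conjHull K g x : Set G) := by
  refine mem_normalizer_of_le_conjIn (conjHull_le (fun y hy => ?_) (fun k => ?_))
  · have := mem_conjIn.1 (le_conjIn_of_mem_normalizer hg hy)
    exact mem_conjIn.2 ⟨le_conjHull K g x this.1, le_conjHull K g x this.2⟩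
  · refine mem_conjIn.2 ⟨?_, ?_⟩
    · have e : g * (g ^ k * x * (g ^ k)⁻¹) * g⁻¹ = g ^ (1 + k) * x * (g ^ (1 + k))⁻¹ := by group
      rw [e]
      exact zpow_conj_mem_conjHull K g x _
    · have e : g⁻¹ * (g ^ k * x * (g ^ k)⁻¹) * g = g ^ (-1 + k) * x * (g ^ (-1 + k))⁻¹ := by group
      rw [e]
      exact zpow_conj_mem_conjHull K g x _

theorem conj_mem_of_mem_normalizer {H : Subgroup G} {g x : G} (hg : g ∈ normalizer (H : Set G))
    (hx : x ∈ H) : g * x * g⁻¹ ∈ H :=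
  (mem_normalizer_iff.1 hg x).1 hx

/-- If `g` normalizes `K` and acts on `x` like an element of `K`, so do all powers of `g`. -/
theorem exists_zpow_conj_eq {K : Subgroup G} {g x : G} (hg : g ∈ normalizer (K : Set G))
    (h : ∃ b ∈ K, g * x * g⁻¹ = b * x * b⁻¹) (k : ℤ) :
    ∃ b ∈ K, g ^ k * x * (g ^ k)⁻¹ = b * x * b⁻¹ := by
  obtain ⟨c, hc, hcx⟩ := h
  induction k using Int.induction_on with
  | zero => exact ⟨1, one_mem _, by simp⟩
  | succ k ih =>
    obtain ⟨b, hb, hbx⟩ := ih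
    refine ⟨g * b * g⁻¹ * c, mul_mem (conj_mem_of_mem_normalizer hg hb) hc, ?_⟩
    calc g ^ ((k : ℤ) + 1) * x * (g ^ ((k : ℤ) + 1))⁻¹
        = g * (g ^ (k : ℤ) * x * (g ^ (k : ℤ))⁻¹) * g⁻¹ := by group
      _ = (g * b * g⁻¹) * (g * x * g⁻¹) * (g * b * g⁻¹)⁻¹ := by rw [hbx]; group
      _ = _ := by rw [hcx]; group
  | pred k ih =>
    obtain ⟨b, hb, hbx⟩ := ih
    have hx : g⁻¹ * x * g = (g⁻¹ * c⁻¹ * g) * x * (g⁻¹ * c⁻¹ * g)⁻¹ := by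
      have : x = c⁻¹ * (g * x * g⁻¹) * c := by rw [hcx]; group
      nth_rw 1 [this]
      group
    have hg' := inv_mem hg
    refine ⟨g⁻¹ * b * g * (g⁻¹ * c⁻¹ * g), mul_mem ?_ ?_, ?_⟩
    · simpa using conj_mem_of_mem_normalizer hg' hb
    · simpa using conj_mem_of_mem_normalizer hg' (inv_mem hc)
    calc g ^ (-(k : ℤ) - 1) * x * (g ^ (-(k : ℤ) - 1))⁻¹
        = g⁻¹ * (g ^ (-(k : ℤ)) * x * (g ^ (-(k : ℤ)))⁻¹) * g := by group
      _ = (g⁻¹ * b * g) * (g⁻¹ * x * g) * (g⁻¹ * b * g)⁻¹ := by rw [hbx]; group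
      _ = _ := by rw [hx]; group

/-- Write k = mq + j with 0 ≤ j < m. The factor (g^m)^q acts on `x` as an element of `K`, so the
conjugates by g^j with j < m suffice. -/
theorem conjHull_fg {K : Subgroup G} (hK : K.FG) {g x : G} (hg : g ∈ normalizer (K : Set G))
    {m : ℕ} (hm : 0 < m) (h : ∃ b ∈ K, g ^ m * x * (g ^ m)⁻¹ = b * x * b⁻¹) :
    (conjHull K g x).FG := by
  let T : Set G := (fun j : ℕ => g ^ j * x * (g ^ j)⁻¹) '' Set.Iio m
  have hT : (closure T).FG := (fg_iff _).2 ⟨T, rfl, (Set.finite_Iio m).image _⟩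
  have e : conjHull K g x = K ⊔ closure T := by
    apply le_antisymm
    · refine conjHull_le le_sup_left fun k => ?_
      obtain ⟨b, hb, hbx⟩ := exists_zpow_conj_eq (pow_mem hg m) h (k / m)
      obtain ⟨j, hj⟩ := Int.eq_ofNat_of_zero_le (Int.emod_nonneg k (by omega : (m : ℤ) ≠ 0))
      have hjm : j < m := by
        have := Int.emod_lt_of_pos k (by omega : (0 : ℤ) < m)
        omega
      have hk : g ^ k = g ^ j * (g ^ m) ^ (k / m) := by
        rw [← zpow_natCast g m, ← zpow_mul, ← zpow_natCast g j, ← zpow_add, ← hj,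
          Int.emod_add_mul_ediv]
      have e : g ^ k * x * (g ^ k)⁻¹ =
          (g ^ j * b * (g ^ j)⁻¹) * (g ^ j * x * (g ^ j)⁻¹) * (g ^ j * b * (g ^ j)⁻¹)⁻¹ := by
        calc g ^ k * x * (g ^ k)⁻¹
            = g ^ j * ((g ^ m) ^ (k / m) * x * ((g ^ m) ^ (k / m))⁻¹) * (g ^ j)⁻¹ := by
              rw [hk]; simp only [mul_inv_rev, mul_assoc]
          _ = _ := by rw [hbx]; simp [mul_assoc]
      have hb' : g ^ j * b * (g ^ j)⁻¹ ∈ K ⊔ closure T :=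
        mem_sup_left (conj_mem_of_mem_normalizer (pow_mem hg j) hb)
      rw [e]
      exact mul_mem (mul_mem hb' (mem_sup_right (subset_closure ⟨j, hjm, rfl⟩))) (inv_mem hb')
    · refine sup_le (le_conjHull K g x) ((closure_le _).2 ?_)
      rintro _ ⟨j, -, rfl⟩
      simpa using zpow_conj_mem_conjHull K g x j
  rw [e]
  exact hK.sup hT

/-- For `x, y, z` satisfying the braid relations on four strands, this is the commutator subgroup of
the group they generate. -/
def braidHull (x y z : G) : Subgroup G :=
  closure {y * x⁻¹, x * (y * x⁻¹) * x⁻¹, z * x⁻¹}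

theorem braidHull_fg (x y z : G) : (braidHull x y z).FG :=
  (fg_iff _).2 ⟨_, rfl, by simp⟩

theorem braidHull_le {x y z : G} {L : Subgroup G} (h1 : y * x⁻¹ ∈ L)
    (h2 : x * (y * x⁻¹) * x⁻¹ ∈ L) (h3 : z * x⁻¹ ∈ L) : braidHull x y z ≤ L := by
  refine (closure_le L).2 ?_
  rintro _ (rfl | rfl | rfl)
  exacts [h1, h2, h3]

theorem braidHull_mem (x y z : G) : y * x⁻¹ ∈ braidHull x y z ∧
    x * (y * x⁻¹) * x⁻¹ ∈ braidHull x y z ∧ z * x⁻¹ ∈ braidHull x y z :=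
  ⟨subset_closure (by simp), subset_closure (by simp), subset_closure (by simp)⟩

theorem braid_inv_conj {x y : G} (h : x * y * x = y * x * y) :
    x⁻¹ * (y * x⁻¹) * x = (y * x⁻¹) * (x * (y * x⁻¹) * x⁻¹)⁻¹ := by
  have : x⁻¹ * y = y * x * y⁻¹ * x⁻¹ := by
    calc x⁻¹ * y = x⁻¹ * (y * x * y) * y⁻¹ * x⁻¹ := by group
      _ = _ := by rw [← h]; group
  calc x⁻¹ * (y * x⁻¹) * x = x⁻¹ * y := by group
    _ = _ := by rw [this]; group

theorem braid_conj_conj {x y : G} (h : x * y * x = y * x * y) :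
    x * (x * (y * x⁻¹) * x⁻¹) * x⁻¹ = (y * x⁻¹)⁻¹ * (x * (y * x⁻¹) * x⁻¹) := by
  calc x * (x * (y * x⁻¹) * x⁻¹) * x⁻¹
      = (x * ((y * x⁻¹) * (x * (y * x⁻¹) * x⁻¹)⁻¹) * x⁻¹)⁻¹ * (x * (y * x⁻¹) * x⁻¹) := by
        simp [mul_assoc]
    _ = _ := by rw [← braid_inv_conj h]; simp [mul_assoc]

/-- With u = y x⁻¹ and w = x u x⁻¹, conjugation by `x` sends u to w and w to u⁻¹w, its inverse sends
u to u w⁻¹, and z x⁻¹ is fixed. -/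
theorem mem_normalizer_braidHull {x y z : G} (h : x * y * x = y * x * y) (c : Commute x z) :
    x ∈ normalizer (braidHull x y z : Set G) := by
  obtain ⟨h1, h2, h3⟩ := braidHull_mem x y z
  refine mem_normalizer_of_le_conjIn (braidHull_le ?_ ?_ ?_)
  · refine mem_conjIn.2 ⟨h2, ?_⟩
    rw [braid_inv_conj h]
    exact mul_mem h1 (inv_mem h2)
  · refine mem_conjIn.2 ⟨?_, by simpa [mul_assoc] using h1⟩
    rw [braid_conj_conj h]
    exact mul_mem (inv_mem h1) h2
  · exact mem_conjIn_of_commute (by simp) (Commute.refl x) h3 (commute_mul_inv c (Commute.refl x))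

/-! ### Four strands -/

/-- The subgroup generated by `braidHull (s 0) (s 1) (s 2)` and the conjugates of
`r 1 * (r 0)⁻¹` by powers of `s 0`. -/
def innerHull (s r : ℕ → G) : Subgroup G :=
  conjHull (braidHull (s 0) (s 1) (s 2)) (s 0) (r 1 * (r 0)⁻¹)

/-- The subgroup generated by `innerHull s r` and the conjugates of
`r 0 * (r 1 * (r 0)⁻¹) * (r 0)⁻¹` by powers of `s 0`. -/
def outerHull (s r : ℕ → G) : Subgroup G :=
  conjHull (innerHull s r) (s 0) (r 0 * (r 1 * (r 0)⁻¹) * (r 0)⁻¹)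

theorem innerHull_le_outerHull (s r : ℕ → G) : innerHull s r ≤ outerHull s r :=
  le_conjHull _ _ _

theorem braidHull_le_innerHull (s r : ℕ → G) :
    braidHull (s 0) (s 1) (s 2) ≤ innerHull s r :=
  le_conjHull _ _ _

namespace Satisfies

variable {s r : ℕ → G}

/-- The mixed relations slide each ρ one place up, and the remaining σ commutes with it. -/
theorem semiconj_up (h : Satisfies 3 s r) :
    SemiconjBy (s 0 * s 1 * s 2) (r 1 * (r 0)⁻¹) (r 2 * (r 1)⁻¹) := by
  have h1 : SemiconjBy (s 0 * s 1 * s 2) (r 1) (r 2) := by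
    rw [mul_assoc]
    exact SemiconjBy.mul_left (h.sr 0 2 (by omega) (by omega))
      (by simpa [SemiconjBy, mul_assoc] using (h.mixedRight 1 (by omega)).symm)
  have h0 : SemiconjBy (s 0 * s 1 * s 2) (r 0) (r 1) :=
    SemiconjBy.mul_left (y := r 0)
      (by simpa [SemiconjBy, mul_assoc] using (h.mixedRight 0 (by omega)).symm)
      (h.rs 0 2 (by omega) (by omega)).symm
  exact h1.mul_right h0.inv_right

theorem semiconj_down (h : Satisfies 3 s r) :
    SemiconjBy (s 2 * s 1 * s 0) (r 2 * (r 1)⁻¹) (r 1 * (r 0)⁻¹) := by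
  have h2 : SemiconjBy (s 2 * s 1 * s 0) (r 2) (r 1) :=
    SemiconjBy.mul_left (y := r 2)
      (by simpa [SemiconjBy, mul_assoc] using (h.mixedLeft 1 (by omega)).symm)
      (h.sr 0 2 (by omega) (by omega))
  have h1 : SemiconjBy (s 2 * s 1 * s 0) (r 1) (r 0) := by
    rw [mul_assoc]
    exact SemiconjBy.mul_left (y := r 0) (h.rs 0 2 (by omega) (by omega)).symm
      (by simpa [SemiconjBy, mul_assoc] using (h.mixedLeft 0 (by omega)).symm)
  exact h2.mul_right h1.inv_right

theorem mem_normalizer_braidHull (h : Satisfies 3 s r) :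
    s 0 ∈ normalizer (braidHull (s 0) (s 1) (s 2) : Set G) :=
  GVBraid.mem_normalizer_braidHull (h.sbraid 0 (by omega)) (h.ss 0 2 (by omega) (by omega))

theorem exists_up_eq (h : Satisfies 3 s r) :
    ∃ a ∈ braidHull (s 0) (s 1) (s 2), s 0 * s 1 * s 2 = a * s 0 ^ 3 := by
  obtain ⟨-, h2, h3⟩ := braidHull_mem (s 0) (s 1) (s 2)
  refine ⟨_, mul_mem h2 h3, ?_⟩
  have c : Commute (s 0 ^ 2) (s 2) := (h.ss 0 2 (by omega) (by omega)).pow_left 2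
  calc s 0 * s 1 * s 2 = s 0 * s 1 * (s 0 ^ 2)⁻¹ * (s 0 ^ 2 * s 2) := by group
    _ = _ := by rw [c.eq]; simp [mul_assoc, pow_succ]

theorem exists_down_eq (s : ℕ → G) :
    ∃ a ∈ braidHull (s 0) (s 1) (s 2), s 2 * s 1 * s 0 = a * s 0 ^ 3 := by
  obtain ⟨-, h2, h3⟩ := braidHull_mem (s 0) (s 1) (s 2)
  exact ⟨_, mul_mem h3 h2, by simp [mul_assoc, pow_succ]⟩

/-- The sixth power of `s 0` acts on `r 1 * (r 0)⁻¹` as an inner automorphism of `braidHull`. -/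
theorem exists_pow_six_conj (h : Satisfies 3 s r) : ∃ b ∈ braidHull (s 0) (s 1) (s 2),
    s 0 ^ 6 * (r 1 * (r 0)⁻¹) * (s 0 ^ 6)⁻¹ = b * (r 1 * (r 0)⁻¹) * b⁻¹ := by
  obtain ⟨a, ha, hau⟩ := h.exists_up_eq
  obtain ⟨b, hb, hbd⟩ := exists_down_eq s
  -- Going up and then down fixes v = r_1 r_0⁻¹; each leg is a `braidHull` element times s_0³,
  -- whence the exponent 6.
  have hsc := h.semiconj_down.mul_left h.semiconj_up
  rw [hau, hbd] at hsc
  have hc := conj_mem_of_mem_normalizer (pow_mem h.mem_normalizer_braidHull 3) ha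
  refine ⟨(b * (s 0 ^ 3 * a * (s 0 ^ 3)⁻¹))⁻¹, inv_mem (mul_mem hb hc), ?_⟩
  have e : b * s 0 ^ 3 * (a * s 0 ^ 3) = b * (s 0 ^ 3 * a * (s 0 ^ 3)⁻¹) * s 0 ^ 6 := by
    simp [mul_assoc, pow_succ]
  rw [e] at hsc
  generalize b * (s 0 ^ 3 * a * (s 0 ^ 3)⁻¹) = g at hsc ⊢
  generalize r 1 * (r 0)⁻¹ = v at hsc ⊢
  calc s 0 ^ 6 * v * (s 0 ^ 6)⁻¹ = g⁻¹ * (g * s 0 ^ 6 * v) * (s 0 ^ 6)⁻¹ := by group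
    _ = _ := by rw [hsc.eq]; simp [mul_assoc]

theorem innerHull_fg (h : Satisfies 3 s r) : (innerHull s r).FG :=
  conjHull_fg (braidHull_fg _ _ _) h.mem_normalizer_braidHull (by omega : 0 < 6)
    h.exists_pow_six_conj

theorem mem_normalizer_innerHull (h : Satisfies 3 s r) :
    s 0 ∈ normalizer (innerHull s r : Set G) :=
  mem_normalizer_conjHull h.mem_normalizer_braidHull _

theorem mem_normalizer_outerHull (h : Satisfies 3 s r) :
    s 0 ∈ normalizer (outerHull s r : Set G) :=
  mem_normalizer_conjHull h.mem_normalizer_innerHull _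

theorem r_one_mem_innerHull (s r : ℕ → G) : r 1 * (r 0)⁻¹ ∈ innerHull s r :=
  self_mem_conjHull _ _ _

theorem r_two_mem_innerHull (h : Satisfies 3 s r) : r 2 * (r 0)⁻¹ ∈ innerHull s r := by
  obtain ⟨a, ha, hau⟩ := h.exists_up_eq
  have ha := braidHull_le_innerHull s r ha
  have hv := conj_mem_of_mem_normalizer (pow_mem h.mem_normalizer_innerHull 3)
    (r_one_mem_innerHull s r)
  have hsc := h.semiconj_up
  rw [hau] at hsc
  have e : r 2 * (r 1)⁻¹ = a * (s 0 ^ 3 * (r 1 * (r 0)⁻¹) * (s 0 ^ 3)⁻¹) * a⁻¹ := by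
    rw [← mul_inv_eq_iff_eq_mul.2 hsc.eq]
    simp [mul_assoc]
  have : r 2 * (r 1)⁻¹ ∈ innerHull s r := by
    rw [e]
    exact mul_mem (mul_mem ha hv) (inv_mem ha)
  simpa [mul_assoc] using mul_mem this (r_one_mem_innerHull s r)

/-- As `r 2` commutes with `s 0`, the commutator of `r 0` with a power of `s 0` depends only on the
difference r_2 r_0⁻¹. -/
theorem commutator_zpow_mem_innerHull (h : Satisfies 3 s r) (k : ℤ) :
    r 0 * s 0 ^ k * (r 0)⁻¹ * (s 0 ^ k)⁻¹ ∈ innerHull s r := by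
  have hc := h.r_two_mem_innerHull
  have hk := conj_mem_of_mem_normalizer (zpow_mem h.mem_normalizer_innerHull k) hc
  have c : Commute (s 0 ^ k) (r 2) := (h.sr 0 2 (by omega) (by omega)).zpow_left k
  have e : r 0 * s 0 ^ k * (r 0)⁻¹ * (s 0 ^ k)⁻¹ =
      (r 2 * (r 0)⁻¹)⁻¹ * (s 0 ^ k * (r 2 * (r 0)⁻¹) * (s 0 ^ k)⁻¹) := by
    rw [← mul_assoc (s 0 ^ k), c.eq]
    simp [mul_assoc]
  rw [e]
  exact mul_mem (inv_mem hc) hk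

theorem commutator_zpow_inv_mem_innerHull (h : Satisfies 3 s r) (k : ℤ) :
    (r 0)⁻¹ * s 0 ^ k * r 0 * (s 0 ^ k)⁻¹ ∈ innerHull s r := by
  have hc := h.r_two_mem_innerHull
  have hk := conj_mem_of_mem_normalizer (zpow_mem h.mem_normalizer_innerHull k) hc
  have c : Commute (s 0 ^ k) (r 2) := (h.sr 0 2 (by omega) (by omega)).zpow_left k
  have cr : Commute (r 0)⁻¹ (r 2) := (h.rr 0 2 (by omega) (by omega)).inv_left
  have e : (r 0)⁻¹ * s 0 ^ k * r 0 * (s 0 ^ k)⁻¹ =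
      (r 2 * (r 0)⁻¹) * (s 0 ^ k * (r 2 * (r 0)⁻¹) * (s 0 ^ k)⁻¹)⁻¹ := by
    rw [← cr.eq]
    have : s 0 ^ k * ((r 0)⁻¹ * r 2) * (s 0 ^ k)⁻¹ = s 0 ^ k * (r 0)⁻¹ * (s 0 ^ k)⁻¹ * r 2 := by
      rw [mul_assoc, mul_assoc, ← c.inv_left.eq]
      simp [mul_assoc]
    rw [this]
    simp [mul_assoc]
  rw [e]
  exact mul_mem hc (inv_mem hk)

theorem r_conj_s_one (h : Satisfies 3 s r) : r 0 * (s 1 * (s 0)⁻¹) * (r 0)⁻¹ =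
    (s 1 * (s 0)⁻¹) * (s 0 ^ (2 : ℤ) * (r 1 * (r 0)⁻¹) * (s 0 ^ (2 : ℤ))⁻¹) *
      (r 0 * s 0 ^ (2 : ℤ) * (r 0)⁻¹ * (s 0 ^ (2 : ℤ))⁻¹)⁻¹ := by
  calc r 0 * (s 1 * (s 0)⁻¹) * (r 0)⁻¹
      = (r 0 * s 1 * s 0) * (s 0)⁻¹ * (s 0)⁻¹ * (r 0)⁻¹ := by simp [mul_assoc]
    _ = _ := by rw [h.mixedLeft 0 (by omega)]; simp [mul_assoc, pow_two]

theorem r_conj_s_conj_s_one (h : Satisfies 3 s r) :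
    r 0 * (s 0 * (s 1 * (s 0)⁻¹) * (s 0)⁻¹) * (r 0)⁻¹ =
      (r 1 * (r 0)⁻¹)⁻¹ * (s 0 * (s 1 * (s 0)⁻¹) * (s 0)⁻¹) *
        (r 0 * s 0 ^ (2 : ℤ) * (r 0)⁻¹ * (s 0 ^ (2 : ℤ))⁻¹)⁻¹ := by
  calc r 0 * (s 0 * (s 1 * (s 0)⁻¹) * (s 0)⁻¹) * (r 0)⁻¹
      = r 0 * (r 1)⁻¹ * (r 1 * s 0 * s 1) * (s 0)⁻¹ * (s 0)⁻¹ * (r 0)⁻¹ := by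
        simp [mul_assoc]
    _ = _ := by rw [h.mixedRight 0 (by omega)]; simp [mul_assoc, pow_two]

/-- `r 0` conjugates `braidHull` into `innerHull`. -/
theorem conj_braidHull_mem_innerHull (h : Satisfies 3 s r) {g : G}
    (hg : g ∈ braidHull (s 0) (s 1) (s 2)) : r 0 * g * (r 0)⁻¹ ∈ innerHull s r := by
  obtain ⟨h1, h2, h3⟩ := braidHull_mem (s 0) (s 1) (s 2)
  have hle := braidHull_le_innerHull s r
  have ht := h.commutator_zpow_mem_innerHull 2
  have hv := r_one_mem_innerHull s r
  suffices braidHull (s 0) (s 1) (s 2) ≤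
      (innerHull s r).comap (MulAut.conj (r 0)).toMonoidHom by simpa using this hg
  refine braidHull_le ?_ ?_ ?_
  · change r 0 * (s 1 * (s 0)⁻¹) * (r 0)⁻¹ ∈ innerHull s r
    rw [h.r_conj_s_one]
    exact mul_mem (mul_mem (hle h1) (zpow_conj_mem_conjHull _ _ _ 2)) (inv_mem ht)
  · change r 0 * (s 0 * (s 1 * (s 0)⁻¹) * (s 0)⁻¹) * (r 0)⁻¹ ∈ innerHull s r
    rw [h.r_conj_s_conj_s_one]
    exact mul_mem (mul_mem (inv_mem hv) (hle h2)) (inv_mem ht)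
  · have e : r 0 * (s 2 * (s 0)⁻¹) * (r 0)⁻¹ =
        (s 2 * (s 0)⁻¹) * (r 0 * s 0 ^ (1 : ℤ) * (r 0)⁻¹ * (s 0 ^ (1 : ℤ))⁻¹)⁻¹ := by
      rw [← mul_assoc, (h.rs 0 2 (by omega) (by omega)).eq]
      simp [mul_assoc]
    change r 0 * (s 2 * (s 0)⁻¹) * (r 0)⁻¹ ∈ innerHull s r
    rw [e]
    exact mul_mem (hle h3) (inv_mem (h.commutator_zpow_mem_innerHull 1))

/-- The relation for s_0⁶ acting on v is conjugated by `r 0`; moving `r 0` past s_0⁶ costs only an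
element of `innerHull`. -/
theorem outerHull_fg (h : Satisfies 3 s r) : (outerHull s r).FG := by
  refine conjHull_fg h.innerHull_fg h.mem_normalizer_innerHull (by omega : 0 < 6) ?_
  obtain ⟨b, hb, hbx⟩ := h.exists_pow_six_conj
  have ht := h.commutator_zpow_mem_innerHull 6
  have hb' := h.conj_braidHull_mem_innerHull hb
  refine ⟨_, mul_mem (inv_mem ht) hb', ?_⟩
  rw [show (6 : ℤ) = ((6 : ℕ) : ℤ) from rfl, zpow_natCast]
  generalize r 1 * (r 0)⁻¹ = v at hbx ⊢
  calc s 0 ^ 6 * (r 0 * v * (r 0)⁻¹) * (s 0 ^ 6)⁻¹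
      = (r 0 * s 0 ^ 6 * (r 0)⁻¹ * (s 0 ^ 6)⁻¹)⁻¹ * r 0 * (s 0 ^ 6 * v * (s 0 ^ 6)⁻¹) *
        (r 0)⁻¹ * (r 0 * s 0 ^ 6 * (r 0)⁻¹ * (s 0 ^ 6)⁻¹) := by simp [mul_assoc]
    _ = _ := by rw [hbx]; simp [mul_assoc]

theorem zpow_conj_mem_conjIn (h : Satisfies 3 s r) {v : G}
    (hv : v ∈ conjIn (outerHull s r) (r 0)) (k : ℤ) :
    s 0 ^ k * v * (s 0 ^ k)⁻¹ ∈ conjIn (outerHull s r) (r 0) := by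
  obtain ⟨h1, h2⟩ := mem_conjIn.1 hv
  have hs := zpow_mem h.mem_normalizer_outerHull k
  refine mem_conjIn.2 ⟨?_, ?_⟩
  · have ht := innerHull_le_outerHull s r (h.commutator_zpow_mem_innerHull k)
    convert mul_mem (mul_mem ht (conj_mem_of_mem_normalizer hs h1)) (inv_mem ht) using 1
    simp [mul_assoc]
  · have ht := innerHull_le_outerHull s r (h.commutator_zpow_inv_mem_innerHull k)
    convert mul_mem (mul_mem ht (conj_mem_of_mem_normalizer hs h2)) (inv_mem ht) using 1
    simp [mul_assoc]

/-- On v and r_0 v r_0⁻¹ the braid relation suffices, and the other powers of `s 0` follow because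
`r 0` commutes with them modulo `innerHull`. On `braidHull` the mixed relations give the forward
conjugates. -/
theorem r_mem_normalizer_outerHull (h : Satisfies 3 s r) :
    r 0 ∈ normalizer (outerHull s r : Set G) := by
  have hle := innerHull_le_outerHull s r
  have hv := hle (r_one_mem_innerHull s r)
  have hv1 : r 0 * (r 1 * (r 0)⁻¹) * (r 0)⁻¹ ∈ outerHull s r := self_mem_conjHull _ _ _
  have hb := h.rbraid 0 (by omega)
  have cv : r 1 * (r 0)⁻¹ ∈ conjIn (outerHull s r) (r 0) := by
    refine mem_conjIn.2 ⟨hv1, ?_⟩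
    rw [braid_inv_conj hb]
    exact mul_mem hv (inv_mem hv1)
  have cv1 : r 0 * (r 1 * (r 0)⁻¹) * (r 0)⁻¹ ∈ conjIn (outerHull s r) (r 0) := by
    refine mem_conjIn.2 ⟨?_, by simpa [mul_assoc] using hv⟩
    rw [braid_conj_conj hb]
    exact mul_mem (inv_mem hv) hv1
  have hfwd : ∀ g ∈ braidHull (s 0) (s 1) (s 2), r 0 * g * (r 0)⁻¹ ∈ outerHull s r :=
    fun g hg => hle (h.conj_braidHull_mem_innerHull hg)
  have hA : ∀ g ∈ braidHull (s 0) (s 1) (s 2), g ∈ outerHull s r :=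
    fun g hg => hle (braidHull_le_innerHull s r hg)
  have ht := hle (h.commutator_zpow_inv_mem_innerHull 2)
  obtain ⟨h1, h2, h3⟩ := braidHull_mem (s 0) (s 1) (s 2)
  refine mem_normalizer_of_le_conjIn (conjHull_le (conjHull_le (braidHull_le ?_ ?_ ?_)
    (h.zpow_conj_mem_conjIn cv)) (h.zpow_conj_mem_conjIn cv1))
  · refine mem_conjIn.2 ⟨hfwd _ h1, ?_⟩
    have hv2 := (mem_conjIn.1 (h.zpow_conj_mem_conjIn cv 2)).2
    have e : (r 0)⁻¹ * (s 1 * (s 0)⁻¹) * r 0 = (s 1 * (s 0)⁻¹) *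
        ((r 0)⁻¹ * s 0 ^ (2 : ℤ) * r 0 * (s 0 ^ (2 : ℤ))⁻¹)⁻¹ *
        ((r 0)⁻¹ * (s 0 ^ (2 : ℤ) * (r 1 * (r 0)⁻¹) * (s 0 ^ (2 : ℤ))⁻¹) * r 0)⁻¹ := by
      have e1 := h.r_conj_s_one
      generalize s 0 ^ (2 : ℤ) = g at e1 ⊢
      generalize g * (r 1 * (r 0)⁻¹) * g⁻¹ = v at e1 ⊢
      generalize s 1 * (s 0)⁻¹ = u at e1 ⊢
      -- The formula for conjugation by `r 0` is solved for conjugation by its inverse.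
      have e2 : u = (r 0)⁻¹ * (u * v * (r 0 * g * (r 0)⁻¹ * g⁻¹)⁻¹) * r 0 := by
        rw [← e1]
        simp [mul_assoc]
      nth_rw 2 [e2]
      simp [mul_assoc]
    rw [e]
    exact mul_mem (mul_mem (hA _ h1) (inv_mem ht)) (inv_mem hv2)
  · refine mem_conjIn.2 ⟨hfwd _ h2, ?_⟩
    have e : (r 0)⁻¹ * (s 0 * (s 1 * (s 0)⁻¹) * (s 0)⁻¹) * r 0 =
        ((r 0)⁻¹ * (r 1 * (r 0)⁻¹) * r 0) * (s 0 * (s 1 * (s 0)⁻¹) * (s 0)⁻¹) *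
        ((r 0)⁻¹ * s 0 ^ (2 : ℤ) * r 0 * (s 0 ^ (2 : ℤ))⁻¹)⁻¹ := by
      have e1 := h.r_conj_s_conj_s_one
      generalize s 0 ^ (2 : ℤ) = g at e1 ⊢
      generalize r 1 * (r 0)⁻¹ = v at e1 ⊢
      generalize s 0 * (s 1 * (s 0)⁻¹) * (s 0)⁻¹ = u at e1 ⊢
      have e2 : u = (r 0)⁻¹ * (v⁻¹ * u * (r 0 * g * (r 0)⁻¹ * g⁻¹)⁻¹) * r 0 := by
        rw [← e1]
        simp [mul_assoc]
      nth_rw 2 [e2]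
      simp [mul_assoc]
    rw [e]
    exact mul_mem (mul_mem (mem_conjIn.1 cv).2 (hA _ h2)) (inv_mem ht)
  · refine mem_conjIn.2 ⟨hfwd _ h3, ?_⟩
    have e : (r 0)⁻¹ * (s 2 * (s 0)⁻¹) * r 0 =
        (s 2 * (s 0)⁻¹) * ((r 0)⁻¹ * s 0 ^ (1 : ℤ) * r 0 * (s 0 ^ (1 : ℤ))⁻¹)⁻¹ := by
      rw [← mul_assoc, (h.rs 0 2 (by omega) (by omega)).inv_left.eq]
      simp [mul_assoc]
    rw [e]
    exact mul_mem (hA _ h3) (inv_mem (hle (h.commutator_zpow_inv_mem_innerHull 1)))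

theorem outerHull_le_commutator (h : Satisfies 3 s r) : outerHull s r ≤ commutator G := by
  have hconj : ∀ g x : G, x ∈ commutator G → g * x * g⁻¹ ∈ commutator G :=
    fun g x hx => Normal.conj_mem inferInstance x hx g
  have hs := h.s_mem_commutator 1 (by omega)
  have hr := h.r_mem_commutator 1 (by omega)
  exact conjHull_le (conjHull_le (braidHull_le hs (hconj _ _ hs) (h.s_mem_commutator 2 (by omega)))
    fun k => hconj _ _ hr) fun k => hconj _ _ (hconj _ _ hr)

end Satisfies

theorem commutator_gvb_four : outerHull (sigma 4) (rho 4) = commutator (GVB 4) := by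
  have S : Satisfies 3 (sigma 4) (rho 4) := satisfies_sigma_rho 4
  have hle := innerHull_le_outerHull (sigma 4) (rho 4)
  obtain ⟨h1, -, h2⟩ := braidHull_mem (sigma 4 0) (sigma 4 1) (sigma 4 2)
  refine le_antisymm S.outerHull_le_commutator (commutator_le_of_normalizer le_rfl ?_ ?_
    S.mem_normalizer_outerHull S.r_mem_normalizer_outerHull)
  · intro i hi
    obtain rfl | rfl | rfl : i = 0 ∨ i = 1 ∨ i = 2 := by omega
    · simp
    · exact hle (braidHull_le_innerHull _ _ h1)
    · exact hle (braidHull_le_innerHull _ _ h2)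
  · intro i hi
    obtain rfl | rfl | rfl : i = 0 ∨ i = 1 ∨ i = 2 := by omega
    · simp
    · exact hle (Satisfies.r_one_mem_innerHull _ _)
    · exact hle S.r_two_mem_innerHull

theorem fg_commutator {n : ℕ} (hn : 4 ≤ n) : Group.FG (commutator (GVB n)) := by
  obtain rfl | hn := hn.eq_or_lt
  · rw [Group.fg_iff_subgroup_fg, ← commutator_gvb_four]
    exact Satisfies.outerHull_fg (satisfies_sigma_rho 4)
  · exact (rank_commutator_le hn).1

/-! ### Three strands -/

/-- Permutations of the alphabet act on the free group. -/
def permAut (α : Type*) : Equiv.Perm α →* MulAut (FreeGroup α) where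
  toFun e := FreeGroup.freeGroupCongr e
  map_one' := FreeGroup.freeGroupCongr_refl
  map_mul' e f := (FreeGroup.freeGroupCongr_trans f e).symm

theorem permAut_of {α : Type*} (e : Equiv.Perm α) (a : α) :
    permAut α e (FreeGroup.of a) = FreeGroup.of (e a) := by
  simp [permAut]

/-- The free group on two letters extended by the permutations of the letters. -/
abbrev SwapExt : Type := FreeGroup Bool ⋊[permAut Bool] Equiv.Perm Bool

/-- The swap is an involution, so both sides of each mixed relation reduce to the letter. -/
theorem satisfies_swapExt : Satisfies 2
    (fun _ => SemidirectProduct.inr (Equiv.swap true false) : ℕ → SwapExt)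
    (fun _ => SemidirectProduct.inl (FreeGroup.of false)) where
  ss _ _ _ _ := Commute.refl _
  rr _ _ _ _ := Commute.refl _
  sr i j hij hj := by omega
  rs i j hij hj := by omega
  sbraid _ _ := rfl
  rbraid _ _ := rfl
  mixedLeft _ _ := by
    rw [mul_assoc, ← map_mul, Equiv.swap_mul_self, map_one, mul_one, one_mul]
  mixedRight _ _ := by
    rw [mul_assoc, ← map_mul, Equiv.swap_mul_self, map_one, mul_one, one_mul]

/-- The homomorphism sending each `σ_i` to the swap and each `ρ_i` to a free generator. -/
noncomputable def toSwapExt : GVB 3 →* SwapExt := lift (n := 3) satisfies_swapExt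

/-- The action of the infinite cyclic group on the free group on `ℤ` by translation of letters. -/
noncomputable def shiftAut : Multiplicative ℤ →* MulAut (FreeGroup ℤ) :=
  (permAut ℤ).comp (zpowersHom _ (Equiv.addRight (1 : ℤ)))

theorem shiftAut_of (k j : ℤ) :
    shiftAut (Multiplicative.ofAdd k) (FreeGroup.of j) = FreeGroup.of (j + k) := by
  simp [shiftAut, permAut_of]

/-- The free group on `ℤ` extended by the translations of `ℤ`. -/
abbrev ShiftExt : Type := FreeGroup ℤ ⋊[shiftAut] Multiplicative ℤ

/-- The homomorphism sending one letter to the translation `t` and the other one to `a t`, where `a`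
is the letter `0`. -/
noncomputable def toShiftExt : FreeGroup Bool →* ShiftExt :=
  FreeGroup.lift fun b =>
    (if b then SemidirectProduct.inl (FreeGroup.of 0) else 1) *
      SemidirectProduct.inr (Multiplicative.ofAdd 1)

/-- The total exponent of a word in two letters, extended to `SwapExt`. -/
noncomputable def exponent : SwapExt →* Multiplicative ℤ :=
  SemidirectProduct.lift (FreeGroup.lift fun _ => Multiplicative.ofAdd 1) 1 (by
    intro e
    ext b
    simp [permAut_of])

theorem toShiftExt_right (w : FreeGroup Bool) :
    (toShiftExt w).right = exponent (SemidirectProduct.inl w) := by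
  have : SemidirectProduct.rightHom.comp toShiftExt = exponent.comp SemidirectProduct.inl := by
    ext b
    cases b <;> simp [toShiftExt, exponent]
  exact DFunLike.congr_fun this w

theorem toSwapExt_right {g : GVB 3} (hg : g ∈ commutator (GVB 3)) : (toSwapExt g).right = 1 := by
  refine commutator_le_ker (n := 3) (SemidirectProduct.rightHom.comp toSwapExt)
    (a := Equiv.swap true false) (b := 1) (Commute.one_right _) (fun i hi => ?_)
    (fun i hi => ?_) hg
  · rw [MonoidHom.comp_apply, toSwapExt, lift_sigma _ hi, SemidirectProduct.rightHom_inr]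
  · rw [MonoidHom.comp_apply, toSwapExt, lift_rho _ hi, SemidirectProduct.rightHom_inl]

theorem toSwapExt_eq_inl {g : GVB 3} (hg : g ∈ commutator (GVB 3)) :
    toSwapExt g = SemidirectProduct.inl (toSwapExt g).left :=
  SemidirectProduct.ext rfl (toSwapExt_right hg)

theorem toShiftExt_toSwapExt_right {g : GVB 3} (hg : g ∈ commutator (GVB 3)) :
    (toShiftExt (toSwapExt g).left).right = 1 := by
  rw [toShiftExt_right, ← toSwapExt_eq_inl hg]
  exact Abelianization.commutator_subset_ker (exponent.comp toSwapExt) hg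

/-- The homomorphism from the commutator subgroup of `GVB 3` to the free group on `ℤ`. -/
noncomputable def commutatorToFree : commutator (GVB 3) →* FreeGroup ℤ where
  toFun g := (toShiftExt (toSwapExt g).left).left
  map_one' := by simp
  -- Left components multiply only up to the action of the right component of `g`, which is trivial
  -- at both stages on the commutator subgroup.
  map_mul' g h := by
    have h1 := toSwapExt_right g.2
    have h2 := toShiftExt_toSwapExt_right g.2
    simp [h1, h2]

theorem of_mem_range_commutatorToFree (k : ℤ) : FreeGroup.of k ∈ commutatorToFree.range := by
  have hc : ⁅sigma 3 0, rho 3 0⁆ ∈ commutator (GVB 3) :=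
    commutator_mem_commutator (mem_top _) (mem_top _)
  -- The commutator maps to the letter 0, and `rho 3 0` maps to the translation, so conjugating by
  -- its `k`-th power gives the letter `k`.
  have hg := Normal.conj_mem inferInstance _ hc (rho 3 0 ^ k)
  refine ⟨⟨_, hg⟩, ?_⟩
  have hs : toSwapExt (sigma 3 0) = SemidirectProduct.inr (Equiv.swap true false) :=
    lift_sigma (n := 3) satisfies_swapExt (by omega)
  have hr : toSwapExt (rho 3 0) = SemidirectProduct.inl (FreeGroup.of false) :=
    lift_rho (n := 3) satisfies_swapExt (by omega)
  have e1 : toSwapExt (rho 3 0 ^ k * ⁅sigma 3 0, rho 3 0⁆ * (rho 3 0 ^ k)⁻¹) =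
      SemidirectProduct.inl (FreeGroup.of false ^ k * (FreeGroup.of true * (FreeGroup.of false)⁻¹) *
        (FreeGroup.of false ^ k)⁻¹) := by
    have h0 : permAut Bool (Equiv.swap true false) (FreeGroup.of false) = FreeGroup.of true := by
      rw [permAut_of, Equiv.swap_apply_right]
    simp only [map_mul, map_inv, map_zpow, commutatorElement_def, hs, hr, ← h0,
      SemidirectProduct.inl_aut]
  have ef : toShiftExt (FreeGroup.of false) =
      SemidirectProduct.inr (Multiplicative.ofAdd 1) := by simp [toShiftExt]
  have et : toShiftExt (FreeGroup.of true) = SemidirectProduct.inl (FreeGroup.of 0) *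
      SemidirectProduct.inr (Multiplicative.ofAdd 1) := by simp [toShiftExt]
  have e2 : toShiftExt (FreeGroup.of false ^ k *
      (FreeGroup.of true * (FreeGroup.of false)⁻¹) * (FreeGroup.of false ^ k)⁻¹) =
      SemidirectProduct.inl (FreeGroup.of k) := by
    have h0 : FreeGroup.of k = shiftAut (Multiplicative.ofAdd 1 ^ k) (FreeGroup.of 0) := by
      rw [← ofAdd_zsmul, shiftAut_of]
      simp
    rw [h0, SemidirectProduct.inl_aut]
    simp only [map_mul, map_inv, map_zpow, ef, et, mul_inv_cancel_right]
  change (toShiftExt (toSwapExt _).left).left = _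
  rw [e1, SemidirectProduct.left_inl, e2, SemidirectProduct.left_inl]

theorem exists_surjective_freeGroup_nat :
    ∃ f : commutator (GVB 3) →* FreeGroup ℕ, Function.Surjective f := by
  have hf : Function.Surjective commutatorToFree := by
    rw [← MonoidHom.range_eq_top, eq_top_iff, ← FreeGroup.closure_range_of, closure_le]
    rintro _ ⟨k, rfl⟩
    exact of_mem_range_commutatorToFree k
  let e : FreeGroup ℤ ≃* FreeGroup ℕ := FreeGroup.freeGroupCongr (Denumerable.eqv ℤ)
  exact ⟨e.toMonoidHom.comp commutatorToFree, e.surjective.comp hf⟩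

/-- A finitely generated free group would make its abelianization, free over ℤ on `α`, a finite
module. -/
theorem not_fg_freeGroup {α : Type*} [Infinite α] : ¬ Group.FG (FreeGroup α) := by
  intro h
  let f : FreeGroup α →* Multiplicative (α →₀ ℤ) :=
    FreeGroup.lift fun a => Multiplicative.ofAdd (Finsupp.single a 1)
  have hf : Function.Surjective f := by
    suffices ∀ x : α →₀ ℤ, ∃ w, f w = Multiplicative.ofAdd x from fun x => this x.toAdd
    intro x
    induction x using Finsupp.induction_linear with
    | zero => exact ⟨1, by simp⟩
    | add x y hx hy =>
      obtain ⟨v, hv⟩ := hx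
      obtain ⟨w, hw⟩ := hy
      exact ⟨v * w, by rw [map_mul, hv, hw, ofAdd_add]⟩
    | single a k =>
      refine ⟨FreeGroup.of a ^ k, ?_⟩
      rw [map_zpow, FreeGroup.lift_apply_of, ← ofAdd_zsmul]
      simp
  have h1 : Group.FG (Multiplicative (α →₀ ℤ)) := Group.fg_of_surjective hf
  have h2 : Module.Finite ℤ (α →₀ ℤ) :=
    Module.Finite.iff_addGroup_fg.2 (AddGroup.fg_iff_mul_fg.2 h1)
  have := Module.Finite.finite_basis (Finsupp.basisSingleOne (R := ℤ) (ι := α))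
  exact not_finite α

theorem not_fg_commutator_gvb_three : ¬ Group.FG (commutator (GVB 3)) := by
  intro h
  obtain ⟨f, hf⟩ := exists_surjective_freeGroup_nat
  exact not_fg_freeGroup (Group.fg_of_surjective hf)

end GVBraid

theorem theorem1p2 :
    -- (i) finite generation for `n ≥ 4`, and the rank bound for `n ≥ 5`
    (∀ n : ℕ, 4 ≤ n → Group.FG ↥(commutator (GVBraid.GVB n))) ∧
    (∀ n : ℕ, 5 ≤ n → ∃ _ : Group.FG ↥(commutator (GVBraid.GVB n)),
      Group.rank ↥(commutator (GVBraid.GVB n)) ≤ 3 * n - 7) ∧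
    -- (ii) the case `n = 3`
    (∃ f : ↥(commutator (GVBraid.GVB 3)) →* FreeGroup ℕ, Function.Surjective f) ∧
    ¬ Group.FG ↥(commutator (GVBraid.GVB 3)) ∧
    -- (iii) perfectness
    (∀ n : ℕ, 3 ≤ n → (GVBraid.IsPerfect ↥(commutator (GVBraid.GVB n)) ↔ 5 ≤ n)) := by
  refine ⟨fun n hn => GVBraid.fg_commutator hn, fun n hn => GVBraid.rank_commutator_le hn,
    GVBraid.exists_surjective_freeGroup_nat, GVBraid.not_fg_commutator_gvb_three,
    fun n hn => ⟨fun hp => ?_, fun h5 => GVBraid.isPerfect_commutator h5⟩⟩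
  by_contra h5
  exact GVBraid.not_isPerfect_commutator hn (by omega) hp
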